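/- Theorem 5.1. A *dimension group* is a partially ordered abelian group $G$ that is directed (every element is a difference of elements of $G^+=\{g : g\ge 0\}$), unperforated (if $n\ge 1$ is an integer and $ng\ge 0$, then $g\ge 0$), and has the Riesz interpolation property (if $a,b\le c,d$, then there is $e$ with $a,b\le e\le c,d$). It is *simple* if it is nonzero and its only order ideals (convex directed subgroups) are $\{0\}$ and $G$. A *trace* on $G$ is a nonzero group homomorphism $\tau: G\to\mathbf{R}$ with $\tau(G^+)\subseteq[0,\infty)$; $G$ has *unique trace* if a trace exists and any two traces are positive real multiples of each other. Let $G$ be a countable simple dimension group with unique trace. Then $G$ is co-rank one ultrasimplicial; that is, there are a function $f:\mathbf{N}\to\mathbf{N}$ (where $0 \in \mathbf{N}$) and integer matrices $A_n$ of size $f(n+1)\times f(n)$ ($n\in\mathbf{N}$) with nonnegative entries such that (i) $G$ is isomorphic, as a partially ordered abelian group, to the direct limit $\varinjlim\,(A_n:\mathbf{Z}^{f(n)}\to\mathbf{Z}^{f(n+1)})$ with the direct limit ordering, whose positive cone consists of the classes $[v,n]$ with $v\in\mathbf{Z}^{f(n)}$ having all entries nonnegative; and (ii) for all $m\ge n$,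 the kernel of the telescoped product $A_mA_{m-1}\cdots A_{n+1}A_n:\mathbf{Z}^{f(n)}\to\mathbf{Z}^{f(m+1)}$ is a free abelian group of rank at most one. -/

import Mathlib

/-- Dimension group, in the axiomatic form: a directed, unperforated partially ordered abelian group
with the Riesz interpolation property. -/
structure IsDimensionGroup (G : Type*) [AddCommGroup G] [PartialOrder G] [IsOrderedAddMonoid G] :
    Prop where
  directed : ∀ g : G, ∃ a b : G, 0 ≤ a ∧ 0 ≤ b ∧ g = a - b
  unperforated : ∀ (n : ℕ) (g : G), 0 < n → 0 ≤ n • g → 0 ≤ g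
  interpolation : ∀ a b c d : G, a ≤ c → a ≤ d → b ≤ c → b ≤ d →
    ∃ e : G, a ≤ e ∧ b ≤ e ∧ e ≤ c ∧ e ≤ d

/-- Order ideal: a convex directed subgroup. -/
structure IsOrderIdeal {G : Type*} [AddCommGroup G] [PartialOrder G] [IsOrderedAddMonoid G]
    (H : AddSubgroup G) : Prop where
  convex : ∀ x y : G, 0 ≤ x → x ≤ y → y ∈ H → x ∈ H
  directed : ∀ h ∈ H, ∃ a ∈ H, ∃ b ∈ H, 0 ≤ a ∧ 0 ≤ b ∧ h = a - b

/-- Simplicity of a partially ordered group: it is nonzero and its only order ideals are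
the trivial ones. -/
structure IsSimpleOrderedGroup (G : Type*) [AddCommGroup G] [PartialOrder G]
    [IsOrderedAddMonoid G] : Prop where
  nontrivial : Nontrivial G
  eq_bot_or_eq_top : ∀ H : AddSubgroup G, IsOrderIdeal H → H = ⊥ ∨ H = ⊤

/-- Trace: a nonzero positive group homomorphism to the reals. -/
structure IsTrace {G : Type*} [AddCommGroup G] [PartialOrder G] [IsOrderedAddMonoid G]
    (τ : G →+ ℝ) : Prop where
  nonneg : ∀ g : G, 0 ≤ g → 0 ≤ τ g
  ne_zero : τ ≠ 0

/-- There is a trace, and it is unique up to multiplication by a positive real. -/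
structure HasUniqueTrace (G : Type*) [AddCommGroup G] [PartialOrder G] [IsOrderedAddMonoid G] :
    Prop where
  exists_trace : ∃ τ : G →+ ℝ, IsTrace τ
  unique : ∀ τ τ' : G →+ ℝ, IsTrace τ → IsTrace τ' → ∃ c : ℝ, 0 < c ∧ ∀ g : G, τ' g = c * τ g

section MatrixSequence

variable {f : ℕ → ℕ} (A : ∀ n : ℕ, Matrix (Fin (f (n + 1))) (Fin (f n)) ℤ)

/-- The telescoped product `A (m - 1) * ⋯ * A (n + 1) * A n`, from level `n` to level `m`
(the identity matrix if `m = n`). -/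
def telescopedProduct {n m : ℕ} (h : n ≤ m) : Matrix (Fin (f m)) (Fin (f n)) ℤ :=
  Nat.leRecOn (C := fun k => Matrix (Fin (f k)) (Fin (f n)) ℤ) h (fun {k} M => A k * M) 1

/-- The map of free abelian groups `x ↦ A (m - 1) ⋯ A n x` given by the telescoped product. -/
def telescopedMap (n m : ℕ) (h : n ≤ m) : (Fin (f n) → ℤ) →ₗ[ℤ] (Fin (f m) → ℤ) :=
  (telescopedProduct A h).mulVecLin

/-- The direct limit of the sequence of abelian groups `A n : ℤ ^ f n → ℤ ^ f (n + 1)`. -/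
abbrev MatrixLimit : Type :=
  Module.DirectLimit (fun n => Fin (f n) → ℤ) (telescopedMap A)

/-- The class `[v, n]` in the direct limit of a vector `v` at level `n`. -/
noncomputable def limitClass (n : ℕ) (v : Fin (f n) → ℤ) : MatrixLimit A :=
  Module.DirectLimit.of ℤ ℕ (fun n => Fin (f n) → ℤ) (telescopedMap A) n v

/-- The positive cone of the direct limit ordering: the classes of the vectors that are
nonnegative for the coordinatewise ordering. -/
def limitCone : Set (MatrixLimit A) :=
  {x | ∃ (n : ℕ) (v : Fin (f n) → ℤ), 0 ≤ v ∧ limitClass A n v = x}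

end MatrixSequence

/-- `G` is isomorphic, as a partially ordered group, to the ordered direct limit of a sequence of
nonnegative integer matrices, all of whose telescoped products have kernel of rank at most one. -/
def IsCoRankOneUltrasimplicial (G : Type*) [AddCommGroup G] [PartialOrder G]
    [IsOrderedAddMonoid G] : Prop :=
  ∃ (f : ℕ → ℕ) (A : ∀ n : ℕ, Matrix (Fin (f (n + 1))) (Fin (f n)) ℤ),
    (∀ n i j, 0 ≤ A n i j) ∧
    (∃ e : G ≃+ MatrixLimit A, ∀ g : G, 0 ≤ g ↔ e g ∈ limitCone A) ∧
    ∀ (n m : ℕ) (h : n ≤ m), Module.finrank ℤ (LinearMap.ker (telescopedMap A n m h)) ≤ 1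

/-! The unique trace τ determines the order: 0 < g iff 0 < τ g. If g is not nonnegative,
unperforation allows G⁺ and -g to be enlarged to a total proper cone; this yields a trace
nonpositive at g, and by uniqueness it is a positive multiple of τ
(`IsDimensionGroup.trace_pos_iff`).

Suppose τ(G) is dense. A finitely generated subgroup F of rank r containing a positive element has a
basis b_j of positive trace. Let M bound the coordinates of finitely many prescribed positive
elements. Simultaneous approximation gives y > 0 such that all w_j = b_j - n_j y have positive
trace, tiny compared with τ y. Then y - M Σ w_j and the w_j are r + 1 positive elements whose span
contains F, so their relations have rank at most one, and the prescribed elements have nonnegative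
coefficients in them (`factorsThroughCoRankOne_of_dense`). If τ(G) is cyclic, interpolation forces G
to be a copy of ℤ.

Iterating along an enumeration of G, each family is rewritten in the next one through a subgroup of
G, so its relations die after one step and the limit is G. A telescoped product kills only relations
of its initial family, whence the rank bound. -/

/-! ### Extension of states on unperforated ordered groups -/

section Trace

variable {G : Type*} [AddCommGroup G]

/-- A total cone in which `u` is a strictly positive order unit induces a normalised real valued
homomorphism that is nonnegative on the cone. -/
theorem AddSubmonoid.exists_addMonoidHom_of_total (P : AddSubmonoid G) (u : G)
    (htotal : ∀ x, x ∈ P ∨ -x ∈ P) (hneg : ∀ n : ℕ, 0 < n → -(n • u) ∉ P)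
    (hunit : ∀ x, ∃ n : ℕ, n • u - x ∈ P) :
    ∃ σ : G →+ ℝ, 0 < σ u ∧ ∀ x ∈ P, 0 ≤ σ x := by
  have hpos : ∀ z : ℤ, z • u ∈ P → 0 ≤ z := by
    intro z hz
    by_contra! h
    obtain ⟨n, rfl⟩ := Int.eq_negSucc_of_lt_zero h
    refine hneg (n + 1) n.succ_pos ?_
    rw [negSucc_zsmul] at hz
    exact hz
  have hcomp : ∀ (x : G) (q q' : ℕ) (p p' : ℤ), q • x - p • u ∈ P → p' • u - q' • x ∈ P →
      (q' : ℤ) * p ≤ q * p' := by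
    intro x q q' p p' h h'
    have := P.add_mem (P.nsmul_mem h q') (P.nsmul_mem h' q)
    have h2 : q' • (q • x - p • u) + q • (p' • u - q' • x) = ((q : ℤ) * p' - q' * p) • u := by
      simp only [← natCast_zsmul]
      module
    rw [h2] at this
    have := hpos _ this
    linarith
  -- The integer part of x measured in units of u; totality of the cone gives the upper estimate.
  have hfloor : ∀ x : G, ∃ p : ℤ, x - p • u ∈ P ∧ (p + 1) • u - x ∈ P := by
    intro x
    obtain ⟨n, hn⟩ := hunit x
    obtain ⟨m, hm⟩ := hunit (-x)
    have hbdd : ∀ z : ℤ, x - z • u ∈ P → z ≤ n := by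
      intro z hz
      have := hcomp x 1 1 z n (by simpa using hz) (by simpa using hn)
      simpa using this
    obtain ⟨p, hp, hmax⟩ := Int.exists_greatest_of_bdd (P := fun z : ℤ => x - z • u ∈ P)
      ⟨n, hbdd⟩ ⟨-m, by simpa [add_comm, sub_eq_add_neg] using hm⟩
    refine ⟨p, hp, ?_⟩
    rcases htotal (x - (p + 1) • u) with h | h
    · have := hmax _ h
      omega
    · simpa using h
  choose p hp hp' using hfloor
  have hlow : ∀ (x : G) (q q' : ℕ), 0 < q → 0 < q' →
      (p (q • x) : ℝ) / q ≤ (p (q' • x) + 1) / q' := by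
    intro x q q' hq hq'
    have := hcomp x q q' _ _ (hp (q • x)) (hp' (q' • x))
    rw [div_le_div_iff₀ (by positivity) (by positivity)]
    have h2 : ((q' : ℝ)) * p (q • x) ≤ q * (p (q' • x) + 1) := by exact_mod_cast this
    linarith
  have hex : ∀ x : G, ∃ s : ℝ, ∀ q : ℕ, 0 < q →
      (p (q • x) : ℝ) ≤ q * s ∧ q * s ≤ p (q • x) + 1 := by
    intro x
    -- The value at x is the supremum of the lower approximations p(qx)/q over q ≥ 1, hence the
    -- shifted index.
    refine ⟨⨆ q : ℕ, (p ((q + 1) • x) : ℝ) / ((q + 1 : ℕ) : ℝ), fun q hq => ?_⟩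
    obtain ⟨q, rfl⟩ := Nat.exists_eq_succ_of_ne_zero hq.ne'
    have hq0 : (0 : ℝ) < (q.succ : ℕ) := by positivity
    constructor
    · rw [← div_le_iff₀' hq0]
      refine le_ciSup (f := fun q : ℕ => (p ((q + 1) • x) : ℝ) / ((q + 1 : ℕ) : ℝ)) ⟨(p ((1 : ℕ) • x) + 1) / ((1 : ℕ) : ℝ), ?_⟩ q
      rintro _ ⟨r, rfl⟩
      exact hlow x (r + 1) 1 r.succ_pos one_pos
    · rw [← le_div_iff₀' hq0]
      exact ciSup_le fun r => hlow x (r + 1) q.succ r.succ_pos q.succ_pos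
  choose s hs hs' using hex
  have hadd : ∀ x y, s (x + y) = s x + s y := by
    intro x y
    -- The rounding errors do not grow with q, so the defect of additivity must vanish.
    have key : ∀ q : ℕ, 0 < q → (q : ℝ) * |s (x + y) - (s x + s y)| ≤ 3 := by
      intro q hq
      have e : q • (x + y) = q • x + q • y := nsmul_add x y q
      have h1 : p (q • (x + y)) ≤ p (q • x) + p (q • y) + 2 := by
        have := hcomp (q • (x + y)) 1 1 (p (q • (x + y))) (p (q • x) + p (q • y) + 2)
          (by simpa using hp (q • (x + y))) (by
            have := P.add_mem (hp' (q • x)) (hp' (q • y))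
            convert this using 1
            rw [one_smul, e]; module)
        simpa using this
      have h2 : p (q • x) + p (q • y) ≤ p (q • (x + y)) + 1 := by
        have := hcomp (q • (x + y)) 1 1 (p (q • x) + p (q • y)) (p (q • (x + y)) + 1) (by
            have := P.add_mem (hp (q • x)) (hp (q • y))
            convert this using 1
            rw [one_smul, e]; module)
          (by simpa using hp' (q • (x + y)))
        simpa using this
      have h1' : (p (q • (x + y)) : ℝ) ≤ p (q • x) + p (q • y) + 2 := by exact_mod_cast h1
      have h2' : (p (q • x) + p (q • y) : ℝ) ≤ p (q • (x + y)) + 1 := by exact_mod_cast h2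
      have hx := hs x q hq
      have hx' := hs' x q hq
      have hy := hs y q hq
      have hy' := hs' y q hq
      have hxy := hs (x + y) q hq
      have hxy' := hs' (x + y) q hq
      have hq0 : (0 : ℝ) < q := by positivity
      rw [show (q : ℝ) * |s (x + y) - (s x + s y)| = |q * (s (x + y) - (s x + s y))| by
        rw [abs_mul, abs_of_pos hq0], abs_le]
      have : (q : ℝ) * (s (x + y) - (s x + s y)) = q * s (x + y) - q * s x - q * s y := by ring
      constructor <;> linarith
    by_contra hne
    have hpos' : 0 < |s (x + y) - (s x + s y)| := abs_pos.2 (sub_ne_zero.2 hne)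
    obtain ⟨n, hn⟩ := exists_nat_gt (3 / |s (x + y) - (s x + s y)|)
    rw [div_lt_iff₀ hpos'] at hn
    have hn0 : 0 < n := by
      rcases Nat.eq_zero_or_pos n with rfl | h
      · norm_num at hn
      · exact h
    linarith [key n hn0]
  have hle : ∀ x (z : ℤ), x - z • u ∈ P → z ≤ p x + 1 := by
    intro x z hz
    have := hcomp x 1 1 z (p x + 1) (by simpa using hz) (by simpa using hp' x)
    simpa using this
  refine ⟨AddMonoidHom.mk' s hadd, ?_, fun x hx => ?_⟩
  -- Since `hle` loses one unit, u itself would only give a value ≥ 0; doubling leaves 2 σ(u) ≥ 1.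
  · have h1 : (2 : ℤ) ≤ p (2 • u) + 1 := hle _ 2 (by
      have : 2 • u - (2 : ℤ) • u = 0 := by module
      rw [this]; exact P.zero_mem)
    have h2 := hs u 2 two_pos
    have h3 : (2 : ℝ) ≤ p (2 • u) + 1 := by exact_mod_cast h1
    push_cast at h2
    simp only [AddMonoidHom.mk'_apply]
    linarith
  · simp only [AddMonoidHom.mk'_apply]
    by_contra! hlt
    obtain ⟨n, hn⟩ := exists_nat_gt (1 / -s x)
    rw [div_lt_iff₀ (by linarith)] at hn
    have hn0 : 0 < n := by
      rcases Nat.eq_zero_or_pos n with rfl | h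
      · norm_num at hn
      · exact h
    have h1 : (0 : ℤ) ≤ p (n • x) + 1 := hle _ 0 (by simpa using P.nsmul_mem hx n)
    have h2 := hs x n hn0
    have h3 : (0 : ℝ) ≤ p (n • x) + 1 := by exact_mod_cast h1
    linarith

variable [PartialOrder G] [IsOrderedAddMonoid G]

/-- In an unperforated group with order unit `u`, an element that is not nonnegative is sent to a
nonpositive number by some trace. -/
theorem exists_isTrace_apply_nonpos
    (hunperf : ∀ (n : ℕ) (g : G), 0 < n → 0 ≤ n • g → 0 ≤ g) {u : G} (hu : 0 < u)
    (hunit : ∀ x : G, ∃ n : ℕ, x ≤ n • u) {g : G} (hg : ¬ 0 ≤ g) :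
    ∃ σ : G →+ ℝ, IsTrace σ ∧ σ g ≤ 0 := by
  let P₀ : AddSubmonoid G := AddSubmonoid.nonneg G ⊔ AddSubmonoid.multiples (-g)
  -- Otherwise some k • g would be positive with k > 0, and unperforation would give 0 ≤ g.
  have hP₀ : ∀ n : ℕ, 0 < n → -(n • u) ∉ P₀ := by
    intro n hn hmem
    obtain ⟨a, ha, b, ⟨k, rfl⟩, hab⟩ := AddSubmonoid.mem_sup.1 hmem
    have ha : 0 ≤ a := ha
    have hnu : 0 < n • u := nsmul_pos hu hn.ne'
    have hk : k • g = a + n • u := by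
      have : a + k • (-g) = -(n • u) := hab
      rw [smul_neg] at this
      calc k • g = a - (a + -(k • g)) := by abel
        _ = a + n • u := by rw [this]; abel
    have hkpos : 0 < k • g := hk ▸ add_pos_of_nonneg_of_pos ha hnu
    rcases Nat.eq_zero_or_pos k with rfl | hk0
    · simp at hkpos
    · exact hg (hunperf k g hk0 hkpos.le)
  obtain ⟨P, hP₀P, hmax⟩ := zorn_le_nonempty₀
    {P : AddSubmonoid G | ∀ n : ℕ, 0 < n → -(n • u) ∉ P} (by
      intro c hc hchain Q hQ
      refine ⟨sSup c, ?_, fun z hz => le_sSup hz⟩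
      intro n hn hmem
      rw [AddSubmonoid.mem_sSup_of_directedOn ⟨Q, hQ⟩ hchain.directedOn] at hmem
      obtain ⟨R, hR, hmem⟩ := hmem
      exact hc hR n hn hmem) P₀ hP₀
  have hnonneg : ∀ x : G, 0 ≤ x → x ∈ P := fun x hx =>
    hP₀P (AddSubmonoid.mem_sup_left (show x ∈ AddSubmonoid.nonneg G from hx))
  have hext : ∀ x, x ∉ P → ∃ n k : ℕ, 0 < n ∧ ∃ a ∈ P, a + k • x = -(n • u) := by
    intro x hx
    by_contra! hcon
    have hle : P ⊔ AddSubmonoid.multiples x ≤ P := hmax.2 (by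
      intro n hn hmem
      obtain ⟨a, ha, b, ⟨k, rfl⟩, hab⟩ := AddSubmonoid.mem_sup.1 hmem
      exact hcon n k hn a ha hab) le_sup_left
    exact hx (hle (AddSubmonoid.mem_sup_right (AddSubmonoid.mem_multiples x)))
  -- If neither x nor -x could be added, eliminating x between the two obstructions would put a
  -- negative multiple of u into P.
  have htotal : ∀ x, x ∈ P ∨ -x ∈ P := by
    intro x
    by_contra! hcon
    obtain ⟨n, k, hn, a, ha, h⟩ := hext x hcon.1
    obtain ⟨m, l, hm, b, hb, h'⟩ := hext (-x) hcon.2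
    have hk : 0 < k := by
      rcases Nat.eq_zero_or_pos k with rfl | hk
      · refine absurd ?_ (hmax.1 n hn)
        rw [← h]; simpa using ha
      · exact hk
    have hmem := P.add_mem (P.nsmul_mem ha l) (P.nsmul_mem hb k)
    have e : l • a + k • b = -((l * n + k * m) • u) := by
      have h1 : a = -(n • u) - k • x := by rw [← h]; abel
      have h2 : b = -(m • u) + l • x := by rw [← h', smul_neg]; abel
      rw [h1, h2]; module
    rw [e] at hmem
    exact hmax.1 _ (by positivity) hmem
  obtain ⟨σ, hσu, hσ⟩ := P.exists_addMonoidHom_of_total u htotal hmax.1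
    fun x => (hunit x).imp fun n hn => hnonneg _ (sub_nonneg.2 hn)
  refine ⟨σ, ⟨fun x hx => hσ x (hnonneg x hx), ?_⟩, ?_⟩
  · rintro rfl
    simp at hσu
  · have := hσ (-g) (hP₀P (AddSubmonoid.mem_sup_right (AddSubmonoid.mem_multiples (-g))))
    rw [map_neg] at this
    linarith

/-! ### Simple ordered groups and strict positivity of the trace -/

/-- Every nonzero positive element of a simple ordered group is an order unit. -/
theorem IsSimpleOrderedGroup.exists_le_nsmul (hsimple : IsSimpleOrderedGroup G)
    {u : G} (hu : 0 < u) (x : G) :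
    ∃ n : ℕ, x ≤ n • u := by
  -- The order ideal generated by u.
  let H : AddSubgroup G :=
    { carrier := {x | ∃ n : ℕ, -(n • u) ≤ x ∧ x ≤ n • u}
      zero_mem' := ⟨0, by simp⟩
      add_mem' := by
        rintro x y ⟨n, hn, hn'⟩ ⟨m, hm, hm'⟩
        refine ⟨n + m, ?_, ?_⟩
        · rw [add_smul, neg_add]; exact add_le_add hn hm
        · rw [add_smul]; exact add_le_add hn' hm'
      neg_mem' := by
        rintro x ⟨n, hn, hn'⟩
        exact ⟨n, neg_le_neg hn', neg_le.1 hn⟩ }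
  have hmul : ∀ n : ℕ, n • u ∈ H := fun n =>
    ⟨n, (neg_nonpos.2 (nsmul_nonneg hu.le n)).trans (nsmul_nonneg hu.le n), le_rfl⟩
  have hH : IsOrderIdeal H :=
    { convex := by
        rintro x y hx hxy ⟨n, -, hn⟩
        exact ⟨n, (neg_nonpos.2 (nsmul_nonneg hu.le n)).trans hx, hxy.trans hn⟩
      directed := by
        rintro h ⟨n, hn, hn'⟩
        exact ⟨h + n • u, H.add_mem ⟨n, hn, hn'⟩ (hmul n), n • u, hmul n,
          neg_le_iff_add_nonneg.1 hn, nsmul_nonneg hu.le n, by abel⟩ }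
  rcases hsimple.eq_bot_or_eq_top H hH with h | h
  · have : u ∈ H := by simpa using hmul 1
    rw [h, AddSubgroup.mem_bot] at this
    exact absurd this hu.ne'
  · have : x ∈ H := h ▸ AddSubgroup.mem_top x
    obtain ⟨n, -, hn⟩ := this
    exact ⟨n, hn⟩

theorem IsSimpleOrderedGroup.exists_pos (hsimple : IsSimpleOrderedGroup G)
    (hdir : ∀ g : G, ∃ a b : G, 0 ≤ a ∧ 0 ≤ b ∧ g = a - b) : ∃ u : G, 0 < u := by
  by_contra! hcon
  have hz : ∀ a : G, 0 ≤ a → a = 0 := fun a ha => by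
    by_contra hne
    exact hcon a (lt_of_le_of_ne ha (Ne.symm hne))
  obtain ⟨g, hg⟩ := @exists_ne G hsimple.nontrivial 0
  obtain ⟨a, b, ha, hb, rfl⟩ := hdir g
  rw [hz a ha, hz b hb, sub_zero] at hg
  exact hg rfl

/-- In a simple dimension group with unique trace, the strictly positive elements are those with
strictly positive trace. -/
theorem IsDimensionGroup.trace_pos_iff (hdim : IsDimensionGroup G)
    (hsimple : IsSimpleOrderedGroup G) (htrace : HasUniqueTrace G) {τ : G →+ ℝ} (hτ : IsTrace τ)
    (g : G) : 0 < τ g ↔ 0 < g := by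
  constructor
  · intro hg
    have hne : g ≠ 0 := by
      rintro rfl
      simp at hg
    by_contra hcon
    have hg' : ¬ 0 ≤ g := fun h => hcon (lt_of_le_of_ne h hne.symm)
    obtain ⟨u, hu⟩ := hsimple.exists_pos hdim.directed
    obtain ⟨σ, hσ, hσg⟩ := exists_isTrace_apply_nonpos hdim.unperforated hu
      (hsimple.exists_le_nsmul hu) hg'
    obtain ⟨c, hc, h⟩ := htrace.unique τ σ hτ hσ
    rw [h g] at hσg
    linarith [mul_pos hc hg]
  · intro hg
    refine lt_of_le_of_ne (hτ.nonneg g hg.le) fun h0 => hτ.ne_zero ?_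
    -- If τ vanished at the order unit g, it would be nonpositive everywhere, hence zero.
    have hle : ∀ x, τ x ≤ 0 := by
      intro x
      obtain ⟨n, hn⟩ := hsimple.exists_le_nsmul hg x
      have := hτ.nonneg _ (sub_nonneg.2 hn)
      rw [map_sub, map_nsmul, ← h0] at this
      simpa using this
    ext x
    refine le_antisymm (hle x) ?_
    have := hle (-x)
    rw [map_neg] at this
    simpa using this

end Trace

/-! ### One-sided simultaneous Diophantine approximation -/

open Filter in
/-- Simultaneous approximation from below: all multiples `β * t j` lie slightly above integers for
arbitrarily large `β`. -/
theorem exists_real_mul_sub_int_mem_Ioo {r : ℕ} (t : Fin r → ℝ) (ht : ∀ j, 0 < t j) (δ C : ℝ)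
    (hδ : 0 < δ) : ∃ β : ℝ, C < β ∧ ∃ n : Fin r → ℤ, ∀ j, 0 < β * t j - n j ∧ β * t j - n j < δ := by
  obtain ⟨T, hT⟩ : ∃ T : ℝ, ∀ j, t j ≤ T := by
    obtain ⟨T, hT⟩ := (Set.finite_range t).bddAbove
    exact ⟨T, fun j => hT ⟨j, rfl⟩⟩
  obtain ⟨η, hη, hηT⟩ : ∃ η : ℝ, 0 < η ∧ ∀ j, η * t j < δ / 2 := by
    refine ⟨δ / 2 / (max T 0 + 1), by positivity, fun j => ?_⟩
    rw [div_mul_eq_mul_div, div_lt_iff₀ (by positivity)]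
    have := (hT j).trans (le_max_left T 0)
    nlinarith
  let x : Fin r → UnitAddCircle := fun j => (t j : UnitAddCircle)
  have hU : ∀ᶠ y in nhds (0 : Fin r → UnitAddCircle), ∀ j, ‖y j‖ < η * t j := by
    rw [eventually_all]
    intro j
    have hc : ContinuousAt (fun y : Fin r → UnitAddCircle => ‖y j‖) 0 :=
      (continuous_norm.comp (continuous_apply j)).continuousAt
    refine hc.eventually_lt_const ?_
    simpa using mul_pos hη (ht j)
  -- Multiples of a point of the torus return arbitrarily late near 0. Replacing N by N + η turns
  -- the two-sided error below η t_j into one in (0, 2 η t_j), which lies in (0, δ).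
  obtain ⟨N, hNC, hN⟩ := (((mapClusterPt_zero_atTop_nsmul x).frequently hU).and_eventually
    (eventually_ge_atTop (⌈C⌉₊))).exists.imp fun N h => And.intro h.2 h.1
  refine ⟨N + η, ?_, fun j => round (N * t j), fun j => ?_⟩
  · have := (Nat.ceil_le.1 hNC)
    linarith
  · have h := hN j
    have e : (N • x) j = ((N * t j : ℝ) : UnitAddCircle) := by
      simp [x, ← nsmul_eq_mul]
    rw [e, UnitAddCircle.norm_eq, abs_lt] at h
    have := hηT j
    constructor <;> linarith [add_mul (N : ℝ) η (t j)]

/-- A dense subgroup of the reals contains small positive elements `α` such that all the given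
positive reals lie slightly above integral multiples of `α`. -/
theorem AddSubgroup.exists_pos_simultaneous_approximation {S : AddSubgroup ℝ}
    (hS : Dense (S : Set ℝ)) {r : ℕ} (t : Fin r → ℝ) (ht : ∀ j, 0 < t j) {δ ε : ℝ}
    (hδ : 0 < δ) (hε : 0 < ε) :
    ∃ α ∈ S, 0 < α ∧ α < ε ∧ ∃ n : Fin r → ℤ, ∀ j, 0 < t j - n j * α ∧ t j - n j * α < δ * α := by
  obtain ⟨β, hβ, n, hn⟩ := exists_real_mul_sub_int_mem_Ioo t ht δ (1 / ε) hδ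
  have hβ0 : 0 < β := lt_trans (by positivity) hβ
  -- With n fixed, β⁻¹ satisfies these open conditions, so by density an element of S does too.
  have hopen : IsOpen {α : ℝ | 0 < α ∧ α < ε ∧ ∀ j, 0 < t j - n j * α ∧ t j - n j * α < δ * α} := by
    simp only [Set.ofPred_and, Set.ofPred_forall]
    refine (isOpen_lt (by fun_prop) (by fun_prop)).inter ((isOpen_lt (by fun_prop)
      (by fun_prop)).inter (isOpen_iInter_of_finite fun j => ?_))
    exact (isOpen_lt (by fun_prop) (by fun_prop)).inter (isOpen_lt (by fun_prop) (by fun_prop))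
  obtain ⟨α, hα, hαS⟩ := hS.inter_open_nonempty _ hopen ⟨β⁻¹, by positivity, by
    rw [inv_lt_comm₀ hβ0 hε, ← one_div]; exact hβ, fun j => by
      have e : t j - n j * β⁻¹ = (β * t j - n j) * β⁻¹ := by field_simp
      rw [e]
      exact ⟨mul_pos (hn j).1 (by positivity), mul_lt_mul_of_pos_right (hn j).2 (by positivity)⟩⟩
  exact ⟨α, hαS, hα.1, hα.2.1, n, hα.2.2⟩

/-! ### Positive factorization of finitely generated subgroups -/

section Factorization

variable {G : Type*} [AddCommGroup G]

/-- A finite free `ℤ`-module on which an additive real functional is not zero has a basis on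
which the functional is strictly positive. -/
theorem Module.exists_basis_forall_pos (F : Type*) [AddCommGroup F] [Module.Finite ℤ F]
    [Module.Free ℤ F] (τ : F →+ ℝ) (hτ : τ ≠ 0) :
    ∃ (r : ℕ) (b : Module.Basis (Fin r) ℤ F), ∀ j, 0 < τ (b j) := by
  obtain ⟨b, j₀, hj₀⟩ : ∃ (b : Module.Basis (Fin (Module.finrank ℤ F)) ℤ F) (j₀ : _),
      0 < τ (b j₀) := by
    let b := Module.finBasis ℤ F
    obtain ⟨j, hj⟩ : ∃ j, τ (b j) ≠ 0 := by
      by_contra! hcon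
      refine hτ (AddMonoidHom.toIntLinearMap_injective (b.ext fun j => ?_))
      simpa using hcon j
    rcases hj.lt_or_gt with h | h
    · exact ⟨b.map (LinearEquiv.neg ℤ), j, by simpa using h⟩
    · exact ⟨b, j, h⟩
  have hm : ∀ j, ∃ m : ℤ, 0 < τ (b j) + m * τ (b j₀) := by
    intro j
    obtain ⟨m, hm⟩ := exists_int_gt (-τ (b j) / τ (b j₀))
    rw [div_lt_iff₀ hj₀] at hm
    exact ⟨m, by linarith⟩
  choose m hm using hm
  -- The value 0 at j₀ makes b_j ↦ b_j + l(b_j) b_{j₀} a transvection, hence invertible.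
  let l : F →ₗ[ℤ] ℤ := b.constr ℤ (Function.update m j₀ 0)
  have hl : l (b j₀) = 0 := by simp [l]
  refine ⟨_, b.map (LinearEquiv.transvection hl), fun j => ?_⟩
  have e : (b.map (LinearEquiv.transvection hl)) j = b j + l (b j) • b j₀ := by
    simp [LinearMap.transvection.apply]
  rw [e, map_add, map_zsmul, zsmul_eq_mul]
  by_cases h : j = j₀
  · subst h; rw [hl]; simpa using hj₀
  · have : l (b j) = m j := by simp [l, h]
    rw [this]; exact hm j

/-- The inclusion of the subgroup `F` factors through a positive map `v ↦ ∑ i, v i • x i` from some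
`ℤ ^ k` with kernel of rank at most one, in such a way that the elements of `S` have nonnegative
coefficients. -/
def FactorsThroughCoRankOne [PartialOrder G] (F : Submodule ℤ G) (S : Set G) : Prop :=
  ∃ (k : ℕ) (x : Fin k → G) (B : F →ₗ[ℤ] (Fin k → ℤ)),
    (∀ i, 0 ≤ x i) ∧
    Module.finrank ℤ (LinearMap.ker (Fintype.linearCombination ℤ x)) ≤ 1 ∧
    (∀ v : F, Fintype.linearCombination ℤ x (B v) = v) ∧
    ∀ v : F, (v : G) ∈ S → 0 ≤ B v

/-- Rank-nullity: the range has rank at least r, so out of r + 1 at most one is left for the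
relations. -/
theorem finrank_ker_linearCombination_le_one {r : ℕ} (x : Fin (r + 1) → G)
    [IsAddTorsionFree G]
    {F : Submodule ℤ G} (hF : Module.finrank ℤ F = r)
    (hle : F ≤ LinearMap.range (Fintype.linearCombination ℤ x)) :
    Module.finrank ℤ (LinearMap.ker (Fintype.linearCombination ℤ x)) ≤ 1 := by
  have h1 := (LinearMap.ker (Fintype.linearCombination ℤ x)).finrank_quotient_add_finrank
  rw [(Fintype.linearCombination ℤ x).quotKerEquivRange.finrank_eq] at h1
  have h2 := Submodule.finrank_mono hle
  simp at h1
  omega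

theorem factorsThroughCoRankOne_of_dense [PartialOrder G] [IsOrderedAddMonoid G]
    [IsAddTorsionFree G] (τ : G →+ ℝ) (hτ : ∀ g, 0 < τ g ↔ 0 < g)
    (hdense : Dense (τ.range : Set ℝ)) (F : Submodule ℤ G) [Module.Finite ℤ F]
    (hF : ∃ u ∈ F, 0 < u) (S : Set G) (hS : S.Finite) (hpos : ∀ s ∈ S, 0 ≤ s) :
    FactorsThroughCoRankOne F S := by
  obtain ⟨r, b, hb⟩ := Module.exists_basis_forall_pos F
    (τ.comp F.subtype.toAddMonoidHom) (by
      intro h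
      obtain ⟨u, huF, hu⟩ := hF
      have := DFunLike.congr_fun h ⟨u, huF⟩
      exact ((hτ u).2 hu).ne' this)
  -- Zero is set aside because the estimate 1 ≤ N v below needs positive trace.
  let T : Set F := {v | (v : G) ∈ S ∧ v ≠ 0}
  have hT : T.Finite := (hS.preimage Subtype.val_injective.injOn).subset fun v hv => hv.1
  have hTpos : ∀ v ∈ T, 0 < τ v := fun v hv => (hτ _).2
    (lt_of_le_of_ne (hpos _ hv.1) fun h => hv.2 (Subtype.ext h.symm))
  obtain ⟨M, hM⟩ : ∃ M : ℕ, ∀ v ∈ T, ∀ j, |b.repr v j| ≤ M := by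
    obtain ⟨M, hM⟩ := (hT.prod (Set.finite_univ (α := Fin r))).image
      (fun p => (b.repr p.1 p.2).natAbs) |>.bddAbove
    refine ⟨M, fun v hv j => ?_⟩
    have : (b.repr v j).natAbs ≤ M := hM ⟨(v, j), ⟨hv, trivial⟩, rfl⟩
    rw [Int.abs_eq_natAbs]
    exact_mod_cast this
  obtain ⟨ε, hε, hεT⟩ : ∃ ε : ℝ, 0 < ε ∧ ∀ v ∈ T, ε ≤ τ v := by
    rcases T.eq_empty_or_nonempty with h | h
    · exact ⟨1, one_pos, by simp [h]⟩
    · obtain ⟨v, hv, hmin⟩ := hT.exists_minimalFor (fun v : F => τ v) _ h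
      exact ⟨τ v, hTpos v hv, fun w hw => (le_total (τ v) (τ w)).elim id fun h => hmin hw h⟩
  -- This δ gives M Σ τ(w_j) < τ y, so y - M Σ w_j is still positive; τ y < ε makes y smaller in
  -- trace than every element of T.
  obtain ⟨_, ⟨y, rfl⟩, hy, hyε, n, hn⟩ :=
    AddSubgroup.exists_pos_simultaneous_approximation hdense (fun j => τ (b j)) hb
      (δ := 1 / (M * r + 1)) (by positivity) hε
  let w : Fin r → G := fun j => b j - n j • y
  have hw : ∀ j, τ (w j) = τ (b j) - n j * τ y := fun j => by
    simp only [w, map_sub, map_zsmul, zsmul_eq_mul]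
  have hw0 : ∀ j, 0 < τ (w j) := fun j => by rw [hw]; exact (hn j).1
  have hsum : M * ∑ j, τ (w j) < τ y := by
    have h1 : ∑ j, τ (w j) ≤ ∑ _j : Fin r, 1 / (M * r + 1) * τ y :=
      Finset.sum_le_sum fun j _ => by rw [hw]; exact (hn j).2.le
    have h2 : (M : ℝ) * ∑ j, τ (w j) ≤ M * (r * (1 / (M * r + 1) * τ y)) := by
      refine mul_le_mul_of_nonneg_left (h1.trans_eq ?_) (by positivity)
      simp
    refine h2.trans_lt ?_
    have : (M : ℝ) * (r * (1 / (M * r + 1) * τ y)) = M * r * τ y / (M * r + 1) := by ring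
    rw [this, div_lt_iff₀ (by positivity)]
    linarith
  let N : F →ₗ[ℤ] ℤ := ∑ j, n j • b.coord j
  have hN : ∀ v : F, N v = ∑ j, n j * b.repr v j := fun v => by simp [N]
  let x : Fin (r + 1) → G := Fin.cons (y - (M : ℤ) • ∑ j, w j) w
  -- From v = N(v) y + Σ c_j w_j, substituting y = x_0 + M Σ w_j gives the coefficients N(v) and M
  -- N(v) + c_j.
  let B : F →ₗ[ℤ] (Fin (r + 1) → ℤ) :=
    LinearMap.pi (Fin.cons N fun j => (M : ℤ) • N + b.coord j)
  have hB0 : ∀ v, B v 0 = N v := fun v => rfl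
  have hBs : ∀ v j, B v (Fin.succ j) = M * N v + b.repr v j := fun v j => rfl
  have hv : ∀ v : F, (v : G) = ∑ j, b.repr v j • (b j : G) := fun v => by
    have h := congrArg F.subtype (b.sum_repr v)
    rw [map_sum] at h
    exact h.symm
  have hdec : ∀ v : F, (v : G) = N v • y + ∑ j, b.repr v j • w j := fun v => by
    rw [hv v, hN, Finset.sum_smul, ← Finset.sum_add_distrib]
    refine Finset.sum_congr rfl fun j _ => ?_
    simp only [w]
    module
  have hBx : ∀ v : F, Fintype.linearCombination ℤ x (B v) = v := fun v => by
    rw [Fintype.linearCombination_apply, Fin.sum_univ_succ, hdec v]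
    simp only [hB0, hBs, x, Fin.cons_zero, Fin.cons_succ, add_smul, Finset.sum_add_distrib,
      smul_sub, mul_smul, ← Finset.smul_sum]
    rw [smul_comm (N v) (M : ℤ)]
    abel
  refine ⟨r + 1, x, B, ?_, ?_, hBx, ?_⟩
  · intro i
    refine ((hτ _).1 ?_).le
    refine Fin.cases ?_ (fun j => ?_) i
    · simp only [x, Fin.cons_zero, map_sub, map_zsmul, map_sum, zsmul_eq_mul]
      push_cast
      linarith
    · exact hw0 j
  · refine finrank_ker_linearCombination_le_one x (F := F) ?_ ?_
    · simpa using Module.finrank_eq_card_basis b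
    · intro v hvF
      exact ⟨B ⟨v, hvF⟩, hBx ⟨v, hvF⟩⟩
  · intro v hvS
    by_cases hv0 : v = 0
    · rw [hv0, map_zero]
    have hvT : v ∈ T := ⟨hvS, hv0⟩
    have habs : |∑ j, (b.repr v j : ℝ) * τ (w j)| ≤ M * ∑ j, τ (w j) := by
      rw [Finset.mul_sum]
      refine (Finset.abs_sum_le_sum_abs _ _).trans (Finset.sum_le_sum fun j _ => ?_)
      rw [abs_mul, abs_of_pos (hw0 j)]
      refine mul_le_mul_of_nonneg_right ?_ (hw0 j).le
      exact_mod_cast hM v hvT j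
    have hτv : τ v = N v * τ y + ∑ j, (b.repr v j : ℝ) * τ (w j) := by
      rw [hdec v]
      simp only [map_add, map_zsmul, map_sum, zsmul_eq_mul]
    -- The w-part of v has trace below τ y < ε ≤ τ v, so N(v) τ y > 0. Then M N(v) ≥ M absorbs any
    -- coordinate ≥ -M.
    have hNpos : 1 ≤ N v := by
      have h1 := hεT v hvT
      have h2 := (abs_le.1 habs).2
      have h3 : 0 < (N v : ℝ) * τ y := by linarith
      have h4 : 0 < (N v : ℝ) := pos_of_mul_pos_left h3 hy.le
      exact_mod_cast h4
    intro i
    refine Fin.cases ?_ (fun j => ?_) i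
    · rw [hB0]; simp; omega
    · rw [hBs]
      have h1 := (abs_le.1 (hM v hvT j)).1
      have h2 : (M : ℤ) * 1 ≤ M * N v := mul_le_mul_of_nonneg_left hNpos (by positivity)
      simp only [Pi.zero_apply]
      linarith

/-- A dimension group with a faithful trace of cyclic range is generated by one positive
element. -/
theorem exists_forall_eq_zsmul_of_range_eq_closure [PartialOrder G] [IsOrderedAddMonoid G]
    (hinterp : ∀ a b c d : G, a ≤ c → a ≤ d → b ≤ c → b ≤ d →
      ∃ e : G, a ≤ e ∧ b ≤ e ∧ e ≤ c ∧ e ≤ d)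
    (τ : G →+ ℝ) (hτ0 : τ ≠ 0) (hτ : ∀ g, 0 < τ g ↔ 0 < g) {a : ℝ}
    (hrange : τ.range = AddSubgroup.closure {a}) :
    ∃ u : G, 0 < u ∧ ∀ g : G, ∃ n : ℤ, g = n • u := by
  have hmem : ∀ g, ∃ n : ℤ, τ g = n * a := fun g => by
    have : τ g ∈ τ.range := ⟨g, rfl⟩
    rw [hrange, AddSubgroup.mem_closure_singleton] at this
    obtain ⟨n, hn⟩ := this
    exact ⟨n, by rw [← hn, zsmul_eq_mul]⟩
  have ha0 : a ≠ 0 := by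
    rintro rfl
    refine hτ0 (AddMonoidHom.ext fun g => ?_)
    obtain ⟨n, hn⟩ := hmem g
    simpa using hn
  obtain ⟨v, hv⟩ : a ∈ τ.range := hrange ▸ AddSubgroup.mem_closure_singleton_self a
  obtain ⟨u, hu, hmem⟩ : ∃ u, 0 < τ u ∧ ∀ g, ∃ n : ℤ, τ g = n * τ u := by
    rcases ha0.lt_or_gt with h | h
    · refine ⟨-v, by simpa [hv] using h, fun g => ?_⟩
      obtain ⟨n, hn⟩ := hmem g
      exact ⟨-n, by simp [hn, hv]⟩
    · exact ⟨v, by rwa [hv], fun g => by rw [hv]; exact hmem g⟩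
  have hle : ∀ g, 0 ≤ g → g ≠ 0 → 0 < τ g := fun g hg hne =>
    (hτ g).2 (lt_of_le_of_ne hg hne.symm)
  have hker : ∀ k, τ k = 0 → k = 0 := by
    intro k hk
    by_contra hne
    have hn : ∀ g, τ g = 0 → 0 ≤ g → g = 0 := fun g hg h0 => by
      by_contra hne
      exact (hle g h0 hne).ne' hg
    -- If τ e = 0, then e and e - k are nonnegative of trace zero, so k = 0. Otherwise τ e ≥ τ u
    -- with e ≤ u, so e = u; then u ≤ u + k gives 0 ≤ k, and k = 0 again.
    obtain ⟨e, h0e, hke, heu, heuk⟩ := hinterp 0 k u (u + k)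
      ((hτ _).1 hu).le ((hτ _).1 (by simpa [hk] using hu)).le
      (sub_nonneg.1 ((hτ _).1 (by simpa [hk] using hu)).le)
      (by simpa using ((hτ _).1 hu).le)
    obtain ⟨n, hn'⟩ := hmem e
    have hn0 : 0 < n := by
      have h1 : τ e ≠ 0 := fun h => by
        have := hn (e - k) (by simp [h, hk]) (sub_nonneg.2 hke)
        rw [hn e h h0e] at this
        exact hne (by simpa using this)
      have h2 : 0 < τ e := hle e h0e fun h => h1 (by simp [h])
      rw [hn'] at h2
      exact_mod_cast pos_of_mul_pos_left h2 hu.le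
    have hn1 : (1 : ℝ) ≤ n := by exact_mod_cast hn0
    have hue : τ (u - e) ≤ 0 := by
      rw [map_sub, hn']; nlinarith
    have h1 : u = e := by
      by_contra h
      have := hle (u - e) (sub_nonneg.2 heu) (sub_ne_zero.2 h)
      linarith
    subst h1
    have hk0 : 0 ≤ k := by simpa using heuk
    exact hne (hn k hk hk0)
  refine ⟨u, (hτ u).1 hu, fun g => ?_⟩
  obtain ⟨n, hn⟩ := hmem g
  refine ⟨n, sub_eq_zero.1 (hker _ ?_)⟩
  rw [map_sub, map_zsmul, zsmul_eq_mul, hn, sub_self]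

/-- The single element u suffices: relations live in ℤ, so the rank bound is automatic, and
nonnegative elements have nonnegative coefficient. -/
theorem factorsThroughCoRankOne_of_forall_eq_zsmul [PartialOrder G] [IsOrderedAddMonoid G]
    {u : G} (hu : 0 < u) (hgen : ∀ g : G, ∃ n : ℤ, g = n • u) (F : Submodule ℤ G)
    (S : Set G) (hpos : ∀ s ∈ S, 0 ≤ s) : FactorsThroughCoRankOne F S := by
  have hinj : ∀ n m : ℤ, n • u = m • u → n = m := by
    intro n m h
    exact (zsmul_left_strictMono hu).injective h
  choose c hc using hgen
  let B : G →+ ℤ := AddMonoidHom.mk' c fun g h => hinj _ _ (by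
    rw [add_smul, ← hc, ← hc, ← hc])
  refine ⟨1, fun _ => u, LinearMap.pi fun _ => B.toIntLinearMap ∘ₗ F.subtype, fun _ => hu.le,
    ?_, fun v => ?_, fun v hv i => ?_⟩
  · refine (Submodule.finrank_le _).trans ?_
    simp
  · rw [Fintype.linearCombination_apply, Fin.sum_univ_one]
    exact (hc v).symm
  · have := hpos _ hv
    rw [hc v] at this
    by_contra! h
    have h' : c v < 0 := h
    have := (zsmul_left_strictMono hu h').trans_le (this.trans_eq' (zero_zsmul u).symm)
    exact lt_irrefl _ this

end Factorization

/-! ### Refinement of families and maps out of the matrix system -/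

section DirectLimit

variable {G : Type*} [AddCommGroup G] [PartialOrder G]

/-- In a simple dimension group with unique trace, every finitely generated subgroup factors
positively through a free abelian group with kernel of rank at most one. -/
theorem IsDimensionGroup.factorsThroughCoRankOne [IsOrderedAddMonoid G]
    (hdim : IsDimensionGroup G) (hsimple : IsSimpleOrderedGroup G) (htrace : HasUniqueTrace G)
    (F : Submodule ℤ G) [Module.Finite ℤ F] (hF : ∃ u ∈ F, 0 < u) (S : Set G) (hS : S.Finite)
    (hpos : ∀ s ∈ S, 0 ≤ s) : FactorsThroughCoRankOne F S := by
  obtain ⟨τ, hτ⟩ := htrace.exists_trace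
  have hτpos := hdim.trace_pos_iff hsimple htrace hτ
  have : IsAddTorsionFree G := IsAddTorsionFree.of_not_isOfFinAddOrder fun g hg hfin => by
    obtain ⟨n, hn, h⟩ := isOfFinAddOrder_iff_nsmul_eq_zero.1 hfin
    exact hg (le_antisymm (neg_nonneg.1 (hdim.unperforated n _ hn (by rw [smul_neg, h, neg_zero])))
      (hdim.unperforated n _ hn h.ge))
  rcases AddSubgroup.dense_or_cyclic τ.range with h | ⟨a, ha⟩
  · exact factorsThroughCoRankOne_of_dense τ hτpos h F hF S hS hpos
  · obtain ⟨u, hu, hgen⟩ := exists_forall_eq_zsmul_of_range_eq_closure hdim.interpolation τ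
      hτ.ne_zero hτpos ha
    exact factorsThroughCoRankOne_of_forall_eq_zsmul hu hgen F S hpos

variable (G) in
/-- A finite family of positive elements of `G` whose relations form a group of rank at most
one. -/
structure CoRankOneFamily where
  /-- the number of elements -/
  card : ℕ
  /-- the elements -/
  elem : Fin card → G
  nonneg : ∀ i, 0 ≤ elem i
  finrank_ker : Module.finrank ℤ (LinearMap.ker (Fintype.linearCombination ℤ elem)) ≤ 1

/-- The map `v ↦ ∑ i, v i • x i` given by a family. -/
def CoRankOneFamily.toMap (x : CoRankOneFamily G) : (Fin x.card → ℤ) →ₗ[ℤ] G :=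
  Fintype.linearCombination ℤ x.elem

/-- A family can be refined so that all its relations are killed, and a given positive element is
reached. -/
theorem IsDimensionGroup.exists_coRankOneFamily_refinement [IsOrderedAddMonoid G]
    (hdim : IsDimensionGroup G) (hsimple : IsSimpleOrderedGroup G) (htrace : HasUniqueTrace G)
    (x : CoRankOneFamily G) (g : G) :
    ∃ (y : CoRankOneFamily G) (A : Matrix (Fin y.card) (Fin x.card) ℤ), (∀ i j, 0 ≤ A i j) ∧
      (∀ v, y.toMap (A.mulVec v) = x.toMap v) ∧ (∀ v, x.toMap v = 0 → A.mulVec v = 0) ∧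
      (0 ≤ g → ∃ v, 0 ≤ v ∧ y.toMap v = g) := by
  obtain ⟨u, hu⟩ := hsimple.exists_pos hdim.directed
  -- The element g is included in order to be reached, and u so that the span contains a positive
  -- element.
  let T : Set G := Set.range x.elem ∪ {g, u}
  let F : Submodule ℤ G := Submodule.span ℤ T
  have hTfin : T.Finite := (Set.finite_range _).union (Set.toFinite _)
  have : Module.Finite ℤ F := Module.Finite.span_of_finite ℤ hTfin
  have hT : ∀ t ∈ T, t ∈ F := fun t ht => Submodule.subset_span ht
  obtain ⟨k, y, B, hy, hker, hB, hBpos⟩ := hdim.factorsThroughCoRankOne hsimple htrace F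
    ⟨u, hT u (by simp [T]), hu⟩ {t ∈ T | 0 ≤ t} (hTfin.subset fun t ht => ht.1) fun t ht => ht.2
  have hxF : ∀ v, x.toMap v ∈ F := fun v => by
    rw [CoRankOneFamily.toMap, Fintype.linearCombination_apply]
    exact F.sum_mem fun j _ => F.smul_mem _ (hT _ (by simp [T]))
  -- Passing through F, a subgroup of G, is what kills every relation of x.
  let C : (Fin x.card → ℤ) →ₗ[ℤ] (Fin k → ℤ) := B ∘ₗ x.toMap.codRestrict F hxF
  have hA : ∀ v, (LinearMap.toMatrix' C).mulVec v = C v := fun v =>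
    LinearMap.toMatrix'_mulVec C v
  refine ⟨⟨k, y, hy, hker⟩, LinearMap.toMatrix' C, fun i j => ?_, fun v => ?_, fun v hv => ?_,
    fun hg => ?_⟩
  · have e : x.toMap (Pi.single j 1) = x.elem j := by
      simp [CoRankOneFamily.toMap]
    rw [LinearMap.toMatrix'_apply]
    refine hBpos _ ?_ i
    rw [LinearMap.codRestrict_apply, e]
    exact ⟨Or.inl ⟨j, rfl⟩, x.nonneg j⟩
  · rw [hA]
    exact hB _
  · rw [hA]
    have : x.toMap.codRestrict F hxF v = 0 := Subtype.ext hv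
    simp [C, this]
  · have hgT : g ∈ T := by simp [T]
    exact ⟨B ⟨g, hT g hgT⟩, hBpos _ ⟨hgT, hg⟩, hB _⟩

variable {f : ℕ → ℕ} (A : ∀ n : ℕ, Matrix (Fin (f (n + 1))) (Fin (f n)) ℤ)

theorem telescopedMap_self (n : ℕ) (v : Fin (f n) → ℤ) : telescopedMap A n n le_rfl v = v := by
  simp [telescopedMap, telescopedProduct, Nat.leRecOn_self]

theorem telescopedMap_succ {n m : ℕ} (h : n ≤ m) (v : Fin (f n) → ℤ) :
    telescopedMap A n (m + 1) (h.trans m.le_succ) v =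
      (A m).mulVec (telescopedMap A n m h v) := by
  simp [telescopedMap, telescopedProduct, Nat.leRecOn_succ h, Matrix.mulVec_mulVec]

theorem apply_telescopedMap {M : Type*} [AddCommGroup M] (φ : ∀ n, (Fin (f n) → ℤ) →ₗ[ℤ] M)
    (hφ : ∀ n v, φ (n + 1) ((A n).mulVec v) = φ n v) (n m : ℕ) (h : n ≤ m)
    (v : Fin (f n) → ℤ) : φ m (telescopedMap A n m h v) = φ n v := by
  induction m, h using Nat.le_induction with
  | base => rw [telescopedMap_self]
  | succ m h ih => rw [telescopedMap_succ A h, hφ, ih]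

end DirectLimit

/-! ### Assembly of the direct system along an enumeration -/

theorem theorem5p1 (G : Type*) [AddCommGroup G] [PartialOrder G] [IsOrderedAddMonoid G]
    [Countable G] (hdim : IsDimensionGroup G) (hsimple : IsSimpleOrderedGroup G)
    (htrace : HasUniqueTrace G) : IsCoRankOneUltrasimplicial G := by
  choose next mat hmat hcomm hkill hreach using
    hdim.exists_coRankOneFamily_refinement hsimple htrace
  obtain ⟨γ, hγ⟩ := exists_surjective_nat G
  -- Starting from the empty family, stage n + 1 reaches γ n if it is nonnegative.
  let X : ℕ → CoRankOneFamily G := fun n => Nat.rec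
    ⟨0, Fin.elim0, fun i => i.elim0, (Submodule.finrank_le _).trans (by simp)⟩
    (fun n x => next x (γ n)) n
  let f : ℕ → ℕ := fun n => (X n).card
  let A : ∀ n : ℕ, Matrix (Fin (f (n + 1))) (Fin (f n)) ℤ := fun n => mat (X n) (γ n)
  let φ : ∀ n, (Fin (f n) → ℤ) →ₗ[ℤ] G := fun n => (X n).toMap
  have hφA : ∀ n v, φ (n + 1) ((A n).mulVec v) = φ n v := fun n => hcomm (X n) (γ n)
  have hφ := apply_telescopedMap A φ hφA
  let L : MatrixLimit A →ₗ[ℤ] G := Module.DirectLimit.lift ℤ ℕ _ _ φ hφ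
  have hL : ∀ n v, L (limitClass A n v) = φ n v := fun n v =>
    Module.DirectLimit.lift_of φ hφ v
  have hex : ∀ z : MatrixLimit A, ∃ n v, limitClass A n v = z := Module.DirectLimit.exists_of
  have hinj : Function.Injective L := by
    rw [injective_iff_map_eq_zero]
    intro z hz
    obtain ⟨n, v, rfl⟩ := hex z
    rw [hL] at hz
    have h1 : telescopedMap A n (n + 1) n.le_succ v = 0 := by
      rw [telescopedMap_succ A le_rfl, telescopedMap_self]
      exact hkill (X n) (γ n) v hz
    have h2 : limitClass A (n + 1) (telescopedMap A n (n + 1) n.le_succ v) = limitClass A n v :=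
      Module.DirectLimit.of_f
    rw [← h2, h1, limitClass, map_zero]
  have hpos : ∀ g, 0 ≤ g → ∃ z ∈ limitCone A, L z = g := by
    intro g hg
    obtain ⟨n, rfl⟩ := hγ g
    obtain ⟨v, hv, hvg⟩ := hreach (X n) (γ n) hg
    exact ⟨_, ⟨n + 1, v, hv, rfl⟩, (hL (n + 1) v).trans hvg⟩
  have hsurj : Function.Surjective L := by
    intro g
    obtain ⟨a, b, ha, hb, rfl⟩ := hdim.directed g
    obtain ⟨y, -, rfl⟩ := hpos a ha
    obtain ⟨z, -, rfl⟩ := hpos b hb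
    exact ⟨y - z, map_sub L y z⟩
  let e : MatrixLimit A ≃ₗ[ℤ] G := LinearEquiv.ofBijective L ⟨hinj, hsurj⟩
  refine ⟨f, A, fun n => hmat (X n) (γ n), ⟨e.symm.toAddEquiv, fun g => ⟨fun hg => ?_, ?_⟩⟩,
    fun n m h => ?_⟩
  · obtain ⟨z, hz, rfl⟩ := hpos g hg
    have : e.symm (L z) = z := e.symm_apply_apply z
    exact this.symm ▸ hz
  · rintro ⟨n, v, hv, h⟩
    have h' : L (limitClass A n v) = g := by
      rw [h]; exact e.apply_symm_apply g
    rw [← h', hL]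
    change 0 ≤ Fintype.linearCombination ℤ (X n).elem v
    rw [Fintype.linearCombination_apply]
    exact Finset.sum_nonneg fun i _ => zsmul_nonneg ((X n).nonneg i) (hv i)
  -- A vector killed by a telescoped product has image 0 in G, hence is a relation of the family at
  -- level n.
  · refine (Submodule.finrank_mono fun v hv => ?_).trans (X n).finrank_ker
    have := hφ n m h v
    rw [LinearMap.mem_ker.1 hv, map_zero] at this
    exact LinearMap.mem_ker.2 this.symm
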